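/- Let $N\ge 2$ and let $\Omega\subset\mathbb R^N$ be a bounded domain (nonempty, open, connected) with Lipschitz boundary. Let $\mathscr C$ be the set of all $p\in C(\overline\Omega)$ such that $1<\inf_\Omega p\le\sup_\Omega p<N$ and such that, for some $L>0$, $$|p(x)-p(y)|\le-\frac{L}{\log|x-y|}\qquad\text{for all }x,y\in\Omega\text{ with }0<|x-y|\le\tfrac12 .$$ For $p\in\mathscr C$ and a measurable (scalar or vector valued) function $u$ on $\Omega$ let $\varrho_{p(x)}(u)=\int_\Omega|u(x)|^{p(x)}\,dx$; let $L^{p(x)}(\Omega)$ be the space of all $u$ with $\varrho_{p(x)}(u)<\infty$, with the Luxemburg norm $\|u\|_{p(x)}=\inf\{\gamma>0:\varrho_{p(x)}(u/\gamma)\le1\}$. Let $W^{1,p(x)}(\Omega)$ be the space of all $u\in L^{p(x)}(\Omega)$ whose distributional gradient $\nabla u$ is in $L^{p(x)}(\Omega)$, with the norm $\|u\|_{p(x)}+\|\nabla u\|_{p(x)}$, and let $W^{1,p(x)}_0(\Omega)$ be the closure of $C_c^\infty(\Omega)$ in it. For an integer $m\ge1$ put $$\lambda^{(m)}_{p(x)}:=\inf_{K\in\mathcal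 W^{(m)}_{p(x)}}\ \sup_{u\in K}\|\nabla u\|_{p(x)},$$ where $\mathcal W^{(m)}_{p(x)}$ is the family of all compact sets $K\subset\{u\in W^{1,p(x)}_0(\Omega):\|u\|_{p(x)}=1\}$ (in the norm topology of $W^{1,p(x)}_0(\Omega)$) with $K=-K$ and $i(K)\ge m$. Here $i(K)$ is the Krasnosel'skiĭ genus of $K$, that is, the least integer $k\ge 0$ for which there is an odd continuous map $K\to\mathbb R^k\setminus\{0\}$, and $i(K)=\infty$ if there is no such $k$. (The infimum is taken in $[0,\infty]$.) Let $m\ge1$, let $p\in\mathscr C$, and let $(p_h)_{h\in\mathbb N}$ be a sequence in $\mathscr C$ such that, for some $\bar h\ge1$, $$\sup_{h\ge\bar h}\sup_\Omega p_h<\frac{N p_I}{N-p_I},\qquad p_I:=\inf_{h\ge\bar h}\inf_\Omega p_h .$$ Suppose that $p_h\to p$ uniformly in $\Omega$ and that $p(x)\le p_h(x)$ for all $h\in\mathbb N$ and $x\in\Omega$. Then $$\lambda^{(m)}_{p_h(x)}\to\lambda^{(m)}_{p(x)}\qquad\text{as }h\to\infty .$$ -/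

import Mathlib

noncomputable section

open MeasureTheory Filter Topology Set TopologicalSpace
open scoped ENNReal ContDiff RealInnerProductSpace

namespace VarExp

/-- `ℝ^N` with its Euclidean norm. -/
abbrev Euc (N : ℕ) : Type := EuclideanSpace ℝ (Fin N)

/-- The open set `Ω` has Lipschitz boundary: near each of its boundary points `x`, up to a rotation
(the vertical direction being the unit vector `ν`), `Ω` is the strict epigraph of a Lipschitz
function on the hyperplane orthogonal to `ν`. -/
def HasLipschitzBoundary {N : ℕ} (Ω : Opens (Euc N)) : Prop :=
  ∀ x ∈ frontier (Ω : Set (Euc N)), ∃ r > 0, ∃ ν : Euc N, ‖ν‖ = 1 ∧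
    ∃ (C : NNReal) (γ : (ℝ ∙ ν)ᗮ → ℝ), LipschitzWith C γ ∧
      ∀ y ∈ Metric.ball x r, y ∈ Ω ↔ γ ((ℝ ∙ ν)ᗮ.orthogonalProjectionOnto y) < ⟪ν, y⟫

/-- Admissible variable exponents on `Ω`: continuous on `closure Ω`, with
`1 < inf_Ω p`, `sup_Ω p < N`, and log-Hölder continuous on `Ω`. -/
structure Exponent {N : ℕ} (Ω : Opens (Euc N)) where
  toFun : Euc N → ℝ
  continuousOn : ContinuousOn toFun (closure (Ω : Set (Euc N)))
  one_lt_inf : ∃ a : ℝ, 1 < a ∧ ∀ x ∈ Ω, a ≤ toFun x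
  sup_lt_dim : ∃ b : ℝ, b < N ∧ ∀ x ∈ Ω, toFun x ≤ b
  logHolder : ∃ L : ℝ, 0 < L ∧ ∀ x ∈ Ω, ∀ y ∈ Ω, 0 < dist x y → dist x y ≤ 1 / 2 →
    |toFun x - toFun y| ≤ -(L / Real.log (dist x y))

instance {N : ℕ} (Ω : Opens (Euc N)) : CoeFun (Exponent Ω) (fun _ => Euc N → ℝ) :=
  ⟨Exponent.toFun⟩

/-- The class `𝒮` of sequences of admissible exponents: for some `k ≥ 1`,
`sup_{h ≥ k} sup_Ω p_h < N p_I / (N - p_I)`, where `p_I = inf_{h ≥ k} inf_Ω p_h`. -/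
def IsSubcriticalSeq {N : ℕ} {Ω : Opens (Euc N)} (p : ℕ → Exponent Ω) : Prop :=
  ∃ k : ℕ, 1 ≤ k ∧
    let range : Set ℝ := {t | ∃ h, k ≤ h ∧ ∃ x ∈ Ω, t = p h x}
    let pI : ℝ := sInf range
    sSup range < N * pI / (N - pI)

section Luxemburg

variable {V : Type*} [AddCommGroup V] [Module ℝ V] [Norm V]

/-- The Luxemburg functional of a finite, convex, even, definite modular is a norm. -/
theorem luxemburg_core (ρ : V → ℝ≥0∞)
    (hconv : ∀ (u v : V) (a b : ℝ), 0 ≤ a → 0 ≤ b → a + b = 1 →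
      ρ (a • u + b • v) ≤ ENNReal.ofReal a * ρ u + ENNReal.ofReal b * ρ v)
    (hsmul : ∀ (u : V) (a : ℝ), |a| ≤ 1 → ρ (a • u) ≤ ENNReal.ofReal |a| * ρ u)
    (hfin : ∀ u, ρ u < (⊤ : ℝ≥0∞)) (hdef : ∀ u, ρ u = 0 → u = 0)
    (hnorm : ∀ u : V, ‖u‖ = sInf {c : ℝ | 0 < c ∧ ρ (c⁻¹ • u) ≤ 1}) :
    NormedSpace.Core ℝ V := by
  have hg : ∀ u : V, ‖u‖ = gauge {v | ρ v ≤ 1} u := by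
    intro u
    rw [gauge_def', hnorm]
    rfl
  have hbal : Balanced ℝ {v | ρ v ≤ 1} := by
    rintro a ha _ ⟨v, hv, rfl⟩
    exact (hsmul v a ha).trans (mul_le_one' (ENNReal.ofReal_le_one.2 ha) hv)
  have hcvx : Convex ℝ {v | ρ v ≤ 1} := by
    intro u hu v hv a b ha hb hab
    refine (hconv u v a b ha hb hab).trans ?_
    calc _ ≤ ENNReal.ofReal a * 1 + ENNReal.ofReal b * 1 := by gcongr <;> assumption
      _ = 1 := by rw [mul_one, mul_one, ← ENNReal.ofReal_add ha hb, hab, ENNReal.ofReal_one]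
  have habs : Absorbent ℝ {v | ρ v ≤ 1} := by
    refine absorbent_iff_eventually_nhdsNE_zero.2 fun u => ?_
    have hlim : Tendsto (fun a : ℝ => ENNReal.ofReal |a| * ρ u) (𝓝 0) (𝓝 0) := by
      have h1 : Tendsto (fun a : ℝ => ENNReal.ofReal |a|) (𝓝 0) (𝓝 0) := by
        have := (ENNReal.continuous_ofReal.comp continuous_abs).tendsto (0 : ℝ)
        simpa [Function.comp_def] using this
      simpa using ENNReal.Tendsto.mul_const h1 (Or.inr (hfin u).ne)
    refine nhdsWithin_le_nhds ?_
    filter_upwards [hlim.eventually_le_const zero_lt_one,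
      Metric.closedBall_mem_nhds (0 : ℝ) zero_lt_one] with a ha ha'
    exact (hsmul u a (by simpa using ha')).trans ha
  refine
    { norm_nonneg := fun u => by rw [hg]; exact gauge_nonneg u
      norm_smul := fun a u => by rw [hg, hg]; exact gauge_smul hbal a u
      norm_triangle := fun u v => by simp only [hg]; exact gauge_add_le hcvx habs u v
      norm_eq_zero_iff := fun u => ⟨fun h => ?_, fun h => by rw [h, hg, gauge_zero]⟩ }
  have key : ∀ ε : ℝ, 0 < ε → ε ≤ 1 → ρ u ≤ ENNReal.ofReal ε := by
    intro ε hε hε1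
    rw [hg] at h
    obtain ⟨c, hc, hcε, v, hv, rfl⟩ := exists_lt_of_gauge_lt habs (h.trans_lt hε)
    have hc1 : |c| ≤ 1 := by rw [abs_of_pos hc]; exact hcε.le.trans hε1
    have h2 := hsmul v c hc1
    rw [abs_of_pos hc] at h2
    calc _ ≤ _ := h2
      _ ≤ ENNReal.ofReal ε * 1 := mul_le_mul' (ENNReal.ofReal_le_ofReal hcε.le) hv
      _ = _ := mul_one _
  refine hdef u (le_antisymm ?_ bot_le)
  have hl : Tendsto ENNReal.ofReal (𝓝[>] 0) (𝓝 0) := by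
    have := (ENNReal.continuous_ofReal.tendsto (0 : ℝ)).mono_left
      (nhdsWithin_le_nhds (s := Ioi 0))
    simpa using this
  refine ge_of_tendsto hl ?_
  filter_upwards [Ioc_mem_nhdsGT zero_lt_one] with ε hε using key ε hε.1 hε.2

end Luxemburg

section Lebesgue

variable {N : ℕ} {Ω : Opens (Euc N)} (p : Exponent Ω)
variable {F : Type*} [NormedAddCommGroup F]

/-- The modular `∫_Ω |u(x)|^{p(x)} dx`, for (classes of) measurable functions on `Ω` with values in
`F` (`F = ℝ` for functions, `F = ℝ^N` for gradients). -/
def modular (u : Euc N →ₘ[volume.restrict (Ω : Set (Euc N))] F) : ℝ≥0∞ :=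
  ∫⁻ x in (Ω : Set (Euc N)), ‖u x‖ₑ ^ p x

theorem Exponent.ae_one_le : ∀ᵐ x ∂(volume.restrict (Ω : Set (Euc N))), 1 ≤ p x := by
  obtain ⟨a, ha, h⟩ := p.one_lt_inf
  exact (ae_restrict_mem Ω.isOpen.measurableSet).mono fun x hx => ha.le.trans (h x hx)

theorem Exponent.ae_le : ∀ᵐ x ∂(volume.restrict (Ω : Set (Euc N))), p x ≤ N := by
  obtain ⟨a, ha, h⟩ := p.sup_lt_dim
  exact (ae_restrict_mem Ω.isOpen.measurableSet).mono fun x hx => (h x hx).trans ha.le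

theorem aemeasurable_rpow (u : Euc N →ₘ[volume.restrict (Ω : Set (Euc N))] F) :
    AEMeasurable (fun x => ‖u x‖ₑ ^ p x) (volume.restrict (Ω : Set (Euc N))) :=
  u.aestronglyMeasurable.enorm.pow
    ((p.continuousOn.mono subset_closure).aemeasurable Ω.isOpen.measurableSet)

theorem modular_zero :
    modular p (0 : Euc N →ₘ[volume.restrict (Ω : Set (Euc N))] F) = 0 := by
  unfold modular
  rw [lintegral_eq_zero_iff' (aemeasurable_rpow p _)]
  filter_upwards [p.ae_one_le, AEEqFun.coeFn_zero (β := F)] with x hp h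
  rw [h]
  simp [zero_lt_one.trans_le hp]

theorem modular_eq_zero {u : Euc N →ₘ[volume.restrict (Ω : Set (Euc N))] F}
    (hu : modular p u = 0) : u = 0 := by
  unfold modular at hu
  rw [lintegral_eq_zero_iff' (aemeasurable_rpow p _)] at hu
  apply AEEqFun.ext
  filter_upwards [p.ae_one_le, AEEqFun.coeFn_zero (β := F), hu] with x hp h h'
  rw [h]
  have := (ENNReal.rpow_eq_zero_iff_of_pos (zero_lt_one.trans_le hp)).1 h'
  simpa using this

variable [NormedSpace ℝ F]

theorem modular_convex (u v : Euc N →ₘ[volume.restrict (Ω : Set (Euc N))] F) {a b : ℝ}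
    (ha : 0 ≤ a) (hb : 0 ≤ b) (hab : a + b = 1) :
    modular p (a • u + b • v) ≤
      ENNReal.ofReal a * modular p u + ENNReal.ofReal b * modular p v := by
  unfold modular
  rw [← lintegral_const_mul'' _ (aemeasurable_rpow p u),
    ← lintegral_const_mul'' _ (aemeasurable_rpow p v),
    ← lintegral_add_left' ((aemeasurable_rpow p u).const_mul _)]
  apply lintegral_mono_ae
  filter_upwards [p.ae_one_le, AEEqFun.coeFn_add (a • u) (b • v), AEEqFun.coeFn_smul a u,
    AEEqFun.coeFn_smul b v] with x hp h1 h2 h3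
  rw [h1, Pi.add_apply, h2, h3, Pi.smul_apply, Pi.smul_apply]
  refine le_trans ?_ (ENNReal.rpow_arith_mean_le_arith_mean2_rpow _ _ _ _ ?_ hp)
  · refine ENNReal.rpow_le_rpow ((enorm_add_le _ _).trans_eq ?_) (zero_le_one.trans hp)
    rw [enorm_smul, enorm_smul, Real.enorm_of_nonneg ha, Real.enorm_of_nonneg hb]
  · rw [← ENNReal.ofReal_add ha hb, hab, ENNReal.ofReal_one]

theorem modular_smul_le (u : Euc N →ₘ[volume.restrict (Ω : Set (Euc N))] F) {a : ℝ}
    (ha : |a| ≤ 1) : modular p (a • u) ≤ ENNReal.ofReal |a| * modular p u := by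
  have h := modular_convex p u 0 (abs_nonneg a) (sub_nonneg.2 ha) (by ring)
  rw [modular_zero, mul_zero, add_zero, smul_zero, add_zero] at h
  refine le_trans (le_of_eq ?_) h
  refine lintegral_congr_ae ?_
  filter_upwards [AEEqFun.coeFn_smul a u, AEEqFun.coeFn_smul |a| u] with x h1 h2
  rw [h1, h2, Pi.smul_apply, Pi.smul_apply, enorm_smul, enorm_smul,
    Real.enorm_eq_ofReal_abs a, Real.enorm_eq_ofReal_abs |a|, abs_abs]

theorem modular_smul_lt_top {u : Euc N →ₘ[volume.restrict (Ω : Set (Euc N))] F} (a : ℝ)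
    (hu : modular p u < (⊤ : ℝ≥0∞)) : modular p (a • u) < (⊤ : ℝ≥0∞) := by
  have h : modular p (a • u) ≤ (1 + ‖a‖ₑ) ^ (N : ℝ) * modular p u := by
    unfold modular
    rw [← lintegral_const_mul'' _ (aemeasurable_rpow p u)]
    apply lintegral_mono_ae
    filter_upwards [p.ae_one_le, p.ae_le, AEEqFun.coeFn_smul a u] with x hp hp' h1
    rw [h1, Pi.smul_apply, enorm_smul, ENNReal.mul_rpow_of_nonneg _ _ (zero_le_one.trans hp)]
    gcongr
    calc ‖a‖ₑ ^ p x ≤ (1 + ‖a‖ₑ) ^ p x :=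
          ENNReal.rpow_le_rpow le_add_self (zero_le_one.trans hp)
      _ ≤ (1 + ‖a‖ₑ) ^ (N : ℝ) := ENNReal.rpow_le_rpow_of_exponent_le le_self_add hp'
  refine h.trans_lt (ENNReal.mul_lt_top ?_ hu)
  exact ENNReal.rpow_lt_top_of_nonneg (Nat.cast_nonneg N) (by simp)

variable (F)

/-- The variable exponent Lebesgue space `L^{p(x)}(Ω)` of `F`-valued functions. -/
def VarLp : Submodule ℝ (Euc N →ₘ[volume.restrict (Ω : Set (Euc N))] F) where
  carrier := {u | modular p u < (⊤ : ℝ≥0∞)}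
  zero_mem' := by
    change modular p 0 < (⊤ : ℝ≥0∞)
    rw [modular_zero]
    exact ENNReal.zero_lt_top
  add_mem' := by
    intro u v hu hv
    have h := modular_convex p ((2 : ℝ) • u) ((2 : ℝ) • v)
      (show (0 : ℝ) ≤ 1 / 2 by norm_num) (show (0 : ℝ) ≤ 1 / 2 by norm_num) (by norm_num)
    rw [smul_smul, smul_smul, show (1 / 2 : ℝ) * 2 = 1 by norm_num, one_smul, one_smul] at h
    exact h.trans_lt (ENNReal.add_lt_top.2
      ⟨ENNReal.mul_lt_top ENNReal.ofReal_lt_top (modular_smul_lt_top p 2 hu),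
        ENNReal.mul_lt_top ENNReal.ofReal_lt_top (modular_smul_lt_top p 2 hv)⟩)
  smul_mem' := fun a _ hu => modular_smul_lt_top p a hu

variable {F}

/-- The Luxemburg norm `inf {γ > 0 : ∫_Ω |u/γ|^{p(x)} dx ≤ 1}`. -/
instance VarLp.instNorm : Norm (VarLp p F) where
  norm u := sInf {c : ℝ | 0 < c ∧
    modular p (c⁻¹ • (u : Euc N →ₘ[volume.restrict (Ω : Set (Euc N))] F)) ≤ 1}

theorem VarLp.core : NormedSpace.Core ℝ (VarLp p F) :=
  luxemburg_core
    (fun u : VarLp p F => modular p (u : Euc N →ₘ[volume.restrict (Ω : Set (Euc N))] F))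
    (fun u v _ _ ha hb hab => modular_convex p u.1 v.1 ha hb hab)
    (fun u _ ha => modular_smul_le p u.1 ha)
    (fun u => u.2)
    (fun _ hu => Subtype.ext (modular_eq_zero p hu))
    (fun _ => rfl)

instance VarLp.instNormedAddCommGroup : NormedAddCommGroup (VarLp p F) :=
  NormedAddCommGroup.ofCore (VarLp.core p)

instance VarLp.instNormedSpace : NormedSpace ℝ (VarLp p F) :=
  NormedSpace.ofCore (VarLp.core p)

end Lebesgue

section Sobolev

variable {N : ℕ} {Ω : Opens (Euc N)}

/-- `φ ∈ C_c^∞(Ω)`. -/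
structure IsTestFunction (Ω : Opens (Euc N)) (φ : Euc N → ℝ) : Prop where
  smooth : ContDiff ℝ ∞ φ
  compact : HasCompactSupport φ
  supp : tsupport φ ⊆ (Ω : Set (Euc N))

/-- `G` is the distributional gradient of `u` in `Ω`. -/
def IsWeakGradient (Ω : Opens (Euc N)) (u : Euc N → ℝ) (G : Euc N → Euc N) : Prop :=
  ∀ φ : Euc N → ℝ, IsTestFunction Ω φ → ∀ v : Euc N,
    ∫ x in (Ω : Set (Euc N)), u x * fderiv ℝ φ x v =
      -∫ x in (Ω : Set (Euc N)), ⟪G x, v⟫ * φ x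

/-- Pairs `(u, G)` with `u ∈ L^{p(x)}(Ω)`, `G ∈ L^{p(x)}(Ω; ℝ^N)`, normed by
`‖u‖_{p(x)} + ‖G‖_{p(x)}`. A Sobolev function `u` is represented by the pair `(u, ∇u)`. -/
abbrev LpPair (p : Exponent Ω) : Type := WithLp 1 (VarLp p ℝ × VarLp p (Euc N))

/-- The underlying class of functions of `(u, ∇u)`. -/
abbrev LpPair.fn {p : Exponent Ω} (w : LpPair p) :
    Euc N →ₘ[volume.restrict (Ω : Set (Euc N))] ℝ := w.fst

/-- The underlying class of vector fields of `(u, ∇u)`. -/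
abbrev LpPair.grad {p : Exponent Ω} (w : LpPair p) :
    Euc N →ₘ[volume.restrict (Ω : Set (Euc N))] Euc N := w.snd

/-- The variable exponent Sobolev space `W^{1,p(x)}(Ω)`, with norm `‖u‖_{p(x)} + ‖∇u‖_{p(x)}`. -/
def sobolev (p : Exponent Ω) : Set (LpPair p) :=
  {w | IsWeakGradient Ω w.fn w.grad}

/-- `W_0^{1,p(x)}(Ω)`, the closure of `C_c^∞(Ω)` in `W^{1,p(x)}(Ω)`. -/
def sobolevZero (p : Exponent Ω) : Set (LpPair p) :=
  sobolev p ∩ closure {w | w ∈ sobolev p ∧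
    ∃ φ, IsTestFunction Ω φ ∧ w.fn =ᵐ[volume.restrict (Ω : Set (Euc N))] φ}

end Sobolev

/-- The Krasnosel'skii genus of a symmetric set `K`: the least `k` such that there is an odd
continuous map from `K` to `ℝ^k \ {0}`, and `∞` if there is none. -/
def genus {V : Type*} [TopologicalSpace V] [Neg V] (K : Set V) : ℕ∞ :=
  ⨅ (k : ℕ) (_ : ∃ f : V → Euc k, ContinuousOn f K ∧ ∀ u ∈ K, f (-u) = -f u ∧ f u ≠ 0), (k : ℕ∞)

section Eigenvalues

variable {N : ℕ} {Ω : Opens (Euc N)}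

/-- The symmetric compact subsets of `{u ∈ W_0^{1,p(x)}(Ω) : ‖u‖_{p(x)} = 1}` of genus `≥ m`. -/
def minimaxSets (p : Exponent Ω) (m : ℕ) : Set (Set (LpPair p)) :=
  {K | IsCompact K ∧ (∀ u ∈ K, -u ∈ K) ∧ K ⊆ {u | u ∈ sobolevZero p ∧ ‖u.fst‖ = 1} ∧ m ≤ genus K}

/-- The `m`-th variational eigenvalue `inf_K sup_{u ∈ K} ‖∇u‖_{p(x)}`, in `[0, ∞]`. -/
def eigenvalue (p : Exponent Ω) (m : ℕ) : ℝ≥0∞ :=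
  ⨅ K ∈ minimaxSets p m, ⨆ u ∈ K, ENNReal.ofReal ‖u.snd‖

end Eigenvalues

end VarExp

end

/-! Two comparisons of Luxemburg norms carry the proof. Let `p ≤ q ≤ p + δ`. Young's inequality
between the powers `q` and `0` gives `‖u‖_p ≤ (1 + δ|Ω|) ‖u‖_q`. Young's inequality between `p` and
an exponent `s` above `sup q` gives `‖u‖_q ≤ (1 + O(δ)) ‖u‖_p`, provided that the normalised `u` is
bounded in `L^s`.

The minimax is first made independent of the space. If the eigenvalue is `< a`, an almost optimal
set is mapped by an odd continuous map into the span of finitely many test functions, close enough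
to the identity to keep `‖∇φ‖ < a ‖φ‖` (`exists_finite_of_eigenvalue_lt`). Conversely, any compact
symmetric set of coefficients of genus `≥ m` with this inequality gives eigenvalue `≤ a`
(`eigenvalue_le_of_finite`). Test functions lie in all the spaces, so only the norms change with the
exponent.

For the limsup, the coefficient set comes from `p` and is fixed: the norms converge pointwise on its
span, hence uniformly on the compact set. For the liminf, the set comes from `p_h` and varies, so
the estimates must be uniform. The gradient needs only the first comparison. For the function, the
Gagliardo–Nirenberg–Sobolev inequality at `r = p_I` bounds `φ` in `L^s`, `s = Nr/(N - r)`, and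
subcriticality says that `s` exceeds the supremum of the `p_h`. -/

noncomputable section

open MeasureTheory Filter Topology Set TopologicalSpace
open scoped ENNReal ContDiff RealInnerProductSpace

namespace VarExp

/-! ### Pointwise comparison of powers. -/

section Interpolation

/-- Powers are interpolated by Young's inequality. -/
theorem rpow_interpolation (v : NNReal) {a c θ : ℝ} (ha : 0 ≤ a) (hc : 0 ≤ c) (h0 : 0 ≤ θ)
    (h1 : θ ≤ 1) :
    (v : ℝ≥0∞) ^ ((1 - θ) * a + θ * c) ≤
      ENNReal.ofReal (1 - θ) * (v : ℝ≥0∞) ^ a + ENNReal.ofReal θ * (v : ℝ≥0∞) ^ c := by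
  have h1' : 0 ≤ 1 - θ := sub_nonneg.2 h1
  have h := NNReal.geom_mean_le_arith_mean2_weighted (1 - θ).toNNReal θ.toNNReal (v ^ a) (v ^ c)
    (by rw [← Real.toNNReal_add h1' h0, sub_add_cancel, Real.toNNReal_one])
  rw [Real.coe_toNNReal _ h1', Real.coe_toNNReal _ h0, ← NNReal.rpow_mul, ← NNReal.rpow_mul,
    ← NNReal.rpow_add_of_nonneg _ (by positivity) (by positivity), mul_comm a, mul_comm c] at h
  rw [← ENNReal.coe_rpow_of_nonneg _ ha, ← ENNReal.coe_rpow_of_nonneg _ hc,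
    ← ENNReal.coe_rpow_of_nonneg _ (by positivity)]
  exact ENNReal.coe_le_coe.2 h

/-- A smaller power is controlled by a larger one, up to the relative gap of the exponents. -/
theorem rpow_le_rpow_add_gap (v : NNReal) {r q δ : ℝ} (hr : 0 ≤ r) (hrq : r ≤ q) (hq : 1 ≤ q)
    (hδ : q - r ≤ δ) : (v : ℝ≥0∞) ^ r ≤ (v : ℝ≥0∞) ^ q + ENNReal.ofReal δ := by
  have hq0 : 0 < q := by linarith
  have h0 : 0 ≤ (q - r) / q := div_nonneg (by linarith) hq0.le
  have h1 : (q - r) / q ≤ 1 := (div_le_one hq0).2 (by linarith)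
  -- `r` lies between `q` and `0`; the zeroth power contributes only the weight `(q - r)/q ≤ δ`.
  have h := rpow_interpolation v hq0.le le_rfl h0 h1
  rw [show (1 - (q - r) / q) * q + (q - r) / q * 0 = r by field_simp; ring, ENNReal.rpow_zero,
    mul_one] at h
  refine h.trans (add_le_add (mul_le_of_le_one_left' (ENNReal.ofReal_le_one.2 (by linarith))) ?_)
  exact ENNReal.ofReal_le_ofReal ((div_le_self (by linarith) hq).trans hδ)

/-- A slightly larger power is controlled by a smaller one, up to a small multiple of a power with
a much larger exponent. -/
theorem rpow_le_rpow_add_mul (v : NNReal) {p q S s δ : ℝ} (hp : 0 ≤ p) (hpq : p ≤ q) (hqS : q ≤ S)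
    (hs : S < s) (hδ : q - p ≤ δ) :
    (v : ℝ≥0∞) ^ q ≤ (v : ℝ≥0∞) ^ p + ENNReal.ofReal (δ / (s - S)) * (v : ℝ≥0∞) ^ s := by
  have hsp : 0 < s - p := by linarith
  have h0 : 0 ≤ (q - p) / (s - p) := div_nonneg (by linarith) hsp.le
  have h1 : (q - p) / (s - p) ≤ 1 := (div_le_one hsp).2 (by linarith)
  have h := rpow_interpolation v hp (by linarith : 0 ≤ s) h0 h1
  rw [show (1 - (q - p) / (s - p)) * p + (q - p) / (s - p) * s = q by field_simp; ring] at h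
  refine h.trans (add_le_add (mul_le_of_le_one_left' (ENNReal.ofReal_le_one.2 (by linarith))) ?_)
  gcongr
  · linarith
  · linarith

end Interpolation

/-! ### Comparison of modulars and of Luxemburg norms. -/

section Modular

variable {N : ℕ} {Ω : Opens (Euc N)}
variable {F : Type*} [NormedAddCommGroup F]

theorem Exponent.one_le (p : Exponent Ω) {x : Euc N} (hx : x ∈ Ω) : 1 ≤ p x := by
  obtain ⟨a, ha, h⟩ := p.one_lt_inf
  exact ha.le.trans (h x hx)

theorem modular_le_add_gap {p q : Exponent Ω} {δ : ℝ} (hpq : ∀ x ∈ Ω, p x ≤ q x)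
    (hδ : ∀ x ∈ Ω, q x - p x ≤ δ) (u : Euc N →ₘ[volume.restrict (Ω : Set (Euc N))] F) :
    modular p u ≤ modular q u + ENNReal.ofReal δ * volume (Ω : Set (Euc N)) := by
  unfold modular
  rw [← setLIntegral_const, ← lintegral_add_right _ measurable_const]
  refine lintegral_mono_ae ((ae_restrict_mem Ω.isOpen.measurableSet).mono fun x hx => ?_)
  exact rpow_le_rpow_add_gap _ (zero_le_one.trans (p.one_le hx)) (hpq x hx) (q.one_le hx) (hδ x hx)

theorem lintegral_rpow_le_modular_add {q : Exponent Ω} {r : ℝ} (hr : 0 ≤ r) (hrq : ∀ x ∈ Ω, r ≤ q x)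
    (u : Euc N →ₘ[volume.restrict (Ω : Set (Euc N))] F) :
    ∫⁻ x in (Ω : Set (Euc N)), ‖u x‖ₑ ^ r ≤ modular q u + N * volume (Ω : Set (Euc N)) := by
  unfold modular
  rw [← setLIntegral_const, ← lintegral_add_right _ measurable_const]
  refine lintegral_mono_ae ?_
  filter_upwards [ae_restrict_mem Ω.isOpen.measurableSet, q.ae_le] with x hx hN
  have := rpow_le_rpow_add_gap ‖u x‖₊ hr (hrq x hx) (q.one_le hx) (δ := N) (by linarith)
  rwa [ENNReal.ofReal_natCast] at this

theorem modular_le_add_mul {p q : Exponent Ω} {S s δ : ℝ} (hpq : ∀ x ∈ Ω, p x ≤ q x)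
    (hδ : ∀ x ∈ Ω, q x - p x ≤ δ) (hS : ∀ x ∈ Ω, q x ≤ S) (hs : S < s)
    (u : Euc N →ₘ[volume.restrict (Ω : Set (Euc N))] F) :
    modular q u ≤ modular p u +
      ENNReal.ofReal (δ / (s - S)) * ∫⁻ x in (Ω : Set (Euc N)), ‖u x‖ₑ ^ s := by
  unfold modular
  rw [← lintegral_const_mul' _ _ ENNReal.ofReal_ne_top,
    ← lintegral_add_left' (aemeasurable_rpow p u)]
  refine lintegral_mono_ae ((ae_restrict_mem Ω.isOpen.measurableSet).mono fun x hx => ?_)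
  exact rpow_le_rpow_add_mul _ (zero_le_one.trans (p.one_le hx)) (hpq x hx) (hS x hx) hs (hδ x hx)

variable [NormedSpace ℝ F]

theorem VarLp.norm_def {p : Exponent Ω} (u : VarLp p F) :
    ‖u‖ = sInf {c : ℝ | 0 < c ∧
      modular p (c⁻¹ • (u : Euc N →ₘ[volume.restrict (Ω : Set (Euc N))] F)) ≤ 1} := rfl

/-- By convexity and `ρ(0) = 0`, dividing the argument by `M ≥ 1` divides the modular by at least
`M`. This turns additive errors in the modular into factors in the norm. -/
theorem VarLp.norm_le_of_modular_le {p : Exponent Ω} (u : VarLp p F) {c M : ℝ} (hc : 0 < c)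
    (hM : 1 ≤ M) (h : modular p (c⁻¹ • (u : Euc N →ₘ[volume.restrict (Ω : Set (Euc N))] F)) ≤
      ENNReal.ofReal M) : ‖u‖ ≤ c * M := by
  have hM0 : 0 < M := by linarith
  rw [VarLp.norm_def]
  refine csInf_le ⟨0, fun _ hx => hx.1.le⟩ ⟨by positivity, ?_⟩
  rw [mul_inv, mul_comm, mul_smul]
  refine (modular_smul_le p _ ?_).trans ?_
  · rw [abs_of_pos (by positivity)]
    exact inv_le_one_of_one_le₀ hM
  · rw [abs_of_pos (by positivity)]
    refine (mul_le_mul_right h _).trans ?_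
    rw [← ENNReal.ofReal_mul (by positivity), inv_mul_cancel₀ hM0.ne', ENNReal.ofReal_one]

theorem VarLp.modular_le_one_of_norm_lt {p : Exponent Ω} (u : VarLp p F) {c : ℝ} (h : ‖u‖ < c) :
    modular p (c⁻¹ • (u : Euc N →ₘ[volume.restrict (Ω : Set (Euc N))] F)) ≤ 1 := by
  have hc : 0 < c := (norm_nonneg u).trans_lt h
  have hne : {c : ℝ | 0 < c ∧
      modular p (c⁻¹ • (u : Euc N →ₘ[volume.restrict (Ω : Set (Euc N))] F)) ≤ 1}.Nonempty := by
    by_contra hne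
    rw [not_nonempty_iff_eq_empty] at hne
    -- Since `sInf ∅ = 0`, the set of admissible constants must be shown nonempty; the witness is
    -- `ρ(u) + 1`.
    have h1 : 1 ≤ (modular p (u : Euc N →ₘ[volume.restrict (Ω : Set (Euc N))] F)).toReal + 1 := by
      simp
    have hpos : 0 < (modular p (u : Euc N →ₘ[volume.restrict (Ω : Set (Euc N))] F)).toReal + 1 := by
      positivity
    refine (hne.subset ⟨hpos, (modular_smul_le p _ ?_).trans ?_⟩ :
      (modular p (u : Euc N →ₘ[volume.restrict (Ω : Set (Euc N))] F)).toReal + 1 ∈ (∅ : Set ℝ))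
    · rw [abs_of_pos (by positivity)]
      exact inv_le_one_of_one_le₀ h1
    · rw [abs_of_pos (by positivity), ← ENNReal.ofReal_toReal (ne_of_lt u.2),
        ← ENNReal.ofReal_mul (by positivity), ENNReal.ofReal_toReal (ne_of_lt u.2)]
      refine ENNReal.ofReal_le_one.2 ?_
      rw [inv_mul_le_one₀ hpos]
      simp
  rw [VarLp.norm_def] at h
  obtain ⟨d, ⟨hd, hd1⟩, hdc⟩ := exists_lt_of_csInf_lt hne h
  have : c⁻¹ • (u : Euc N →ₘ[volume.restrict (Ω : Set (Euc N))] F) = (c⁻¹ * d) • (d⁻¹ •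
      (u : Euc N →ₘ[volume.restrict (Ω : Set (Euc N))] F)) := by
    rw [smul_smul, mul_assoc, mul_inv_cancel₀ hd.ne', mul_one]
  have hcd : |c⁻¹ * d| ≤ 1 := by
    rw [abs_of_pos (by positivity), inv_mul_le_one₀ hc]
    exact hdc.le
  rw [this]
  exact (modular_smul_le p _ hcd).trans (mul_le_one' (ENNReal.ofReal_le_one.2 hcd) hd1)

/-- The norm of `L^{p(x)}` is almost bounded by the norm of `L^{q(x)}` when `q ≥ p` is close
to `p`. -/
theorem VarLp.norm_le_of_exponent_le {p q : Exponent Ω} {δ : ℝ} (hδ0 : 0 ≤ δ)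
    (hΩ : volume (Ω : Set (Euc N)) ≠ ⊤) (hpq : ∀ x ∈ Ω, p x ≤ q x) (hδ : ∀ x ∈ Ω, q x - p x ≤ δ)
    (u : VarLp p F) (w : VarLp q F)
    (huw : (u : Euc N →ₘ[volume.restrict (Ω : Set (Euc N))] F) = w) :
    ‖u‖ ≤ (1 + δ * volume.real (Ω : Set (Euc N))) * ‖w‖ := by
  -- The modular is at most `1` at every level above the norm; `c` then decreases to `‖w‖`, so
  -- attainment of the infimum is not needed.
  have key : ∀ c, ‖w‖ < c → ‖u‖ ≤ (1 + δ * volume.real (Ω : Set (Euc N))) * c := by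
    intro c hc
    have hc0 : 0 < c := (norm_nonneg w).trans_lt hc
    rw [mul_comm]
    refine VarLp.norm_le_of_modular_le u hc0 (le_add_of_nonneg_right (by positivity)) ?_
    rw [huw]
    refine (modular_le_add_gap hpq hδ _).trans ?_
    rw [ENNReal.ofReal_add zero_le_one (by positivity), ENNReal.ofReal_mul hδ0, ENNReal.ofReal_one,
      ofReal_measureReal hΩ]
    gcongr
    exact VarLp.modular_le_one_of_norm_lt _ hc
  have hlim : Tendsto (fun c => (1 + δ * volume.real (Ω : Set (Euc N))) * c) (𝓝[>] ‖w‖)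
      (𝓝 ((1 + δ * volume.real (Ω : Set (Euc N))) * ‖w‖)) :=
    ((continuous_const.mul continuous_id).tendsto _).mono_left nhdsWithin_le_nhds
  exact ge_of_tendsto hlim (eventually_nhdsWithin_of_forall key)

/-- The norm of `L^{q(x)}` is almost bounded by the norm of `L^{p(x)}` when `q ≥ p` is close
to `p`, on functions bounded in `L^s` for an exponent `s` above `q`. -/
theorem VarLp.norm_le_of_lintegral_le {p q : Exponent Ω} {S s δ B c : ℝ} (hδ0 : 0 ≤ δ)
    (hpq : ∀ x ∈ Ω, p x ≤ q x) (hδ : ∀ x ∈ Ω, q x - p x ≤ δ) (hS : ∀ x ∈ Ω, q x ≤ S) (hs : S < s)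
    (u : VarLp p F) (w : VarLp q F)
    (huw : (u : Euc N →ₘ[volume.restrict (Ω : Set (Euc N))] F) = w) (hc : ‖u‖ < c) (hB : 0 ≤ B)
    (hint : ∫⁻ x in (Ω : Set (Euc N)), ‖(c⁻¹ • (u : Euc N →ₘ[volume.restrict (Ω : Set (Euc N))] F) :
      Euc N →ₘ[volume.restrict (Ω : Set (Euc N))] F) x‖ₑ ^ s ≤ ENNReal.ofReal B) :
    ‖w‖ ≤ c * (1 + δ / (s - S) * B) := by
  have hs' : 0 < s - S := sub_pos.2 hs
  refine VarLp.norm_le_of_modular_le w ((norm_nonneg u).trans_lt hc)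
    (le_add_of_nonneg_right (by positivity)) ?_
  rw [← huw, ENNReal.ofReal_add zero_le_one (by positivity), ENNReal.ofReal_mul (by positivity),
    ENNReal.ofReal_one]
  refine (modular_le_add_mul hpq hδ hS hs _).trans ?_
  gcongr
  exact VarLp.modular_le_one_of_norm_lt _ hc

end Modular

/-! ### Test functions as a common dense subspace of all the spaces. -/

section TestFunctions

variable {N : ℕ} {Ω : Opens (Euc N)}
variable {F : Type*} [NormedAddCommGroup F]

theorem modular_mk (q : Exponent Ω) {f : Euc N → F}
    (hf : AEStronglyMeasurable f (volume.restrict (Ω : Set (Euc N)))) :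
    modular q (AEEqFun.mk f hf) = ∫⁻ x in (Ω : Set (Euc N)), ‖f x‖ₑ ^ q x := by
  refine lintegral_congr_ae ((AEEqFun.coeFn_mk f hf).mono fun x hx => ?_)
  simp only [hx]

theorem modular_mk_lt_top (q : Exponent Ω) {f : Euc N → F} (hf : Continuous f)
    (hc : HasCompactSupport f) :
    modular q (AEEqFun.mk f hf.aestronglyMeasurable) < (⊤ : ℝ≥0∞) := by
  obtain ⟨C, hC⟩ := hc.exists_bound_of_continuous hf
  rw [modular_mk]
  have hle : ∫⁻ x in (Ω : Set (Euc N)), ‖f x‖ₑ ^ q x ≤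
      ∫⁻ x, (tsupport f).indicator (fun _ => (1 + ENNReal.ofReal C) ^ (N : ℝ)) x := by
    refine (lintegral_mono_ae ?_).trans (setLIntegral_le_lintegral _ _)
    filter_upwards [q.ae_one_le, q.ae_le] with x h1 hN
    by_cases hx : x ∈ tsupport f
    · rw [indicator_of_mem hx]
      calc ‖f x‖ₑ ^ q x ≤ (1 + ENNReal.ofReal C) ^ q x := by
            refine ENNReal.rpow_le_rpow ?_ (zero_le_one.trans h1)
            rw [← ofReal_norm]
            exact (ENNReal.ofReal_le_ofReal (hC x)).trans le_add_self
        _ ≤ _ := ENNReal.rpow_le_rpow_of_exponent_le le_self_add hN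
    · rw [indicator_of_notMem hx, image_eq_zero_of_notMem_tsupport hx, enorm_zero,
        ENNReal.zero_rpow_of_pos (zero_lt_one.trans_le h1)]
  refine hle.trans_lt ?_
  rw [lintegral_indicator_const (isClosed_tsupport f).measurableSet]
  refine ENNReal.mul_lt_top ?_ hc.isCompact.measure_lt_top
  exact ENNReal.rpow_lt_top_of_nonneg (Nat.cast_nonneg N) (by simp)

variable (Ω) in
/-- The vector space `C_c^∞(Ω)`. -/
def testSpace : Submodule ℝ (Euc N → ℝ) where
  carrier := {φ | IsTestFunction Ω φ}
  zero_mem' := ⟨contDiff_const, HasCompactSupport.zero, by simp [tsupport]⟩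
  add_mem' hφ hψ := ⟨hφ.smooth.add hψ.smooth, hφ.compact.add hψ.compact,
    (tsupport_add _ _).trans (union_subset hφ.supp hψ.supp)⟩
  smul_mem' a φ hφ := ⟨hφ.smooth.const_smul a, hφ.compact.smul_left (f := fun _ => a),
    (tsupport_smul_subset_right (fun _ => a) φ).trans hφ.supp⟩

theorem IsTestFunction.differentiable {φ : Euc N → ℝ} (hφ : IsTestFunction Ω φ) :
    Differentiable ℝ φ := hφ.smooth.differentiable (by simp)

theorem IsTestFunction.continuous_gradient {φ : Euc N → ℝ} (hφ : IsTestFunction Ω φ) :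
    Continuous (gradient φ) :=
  (InnerProductSpace.toDual ℝ (Euc N)).symm.continuous.comp (hφ.smooth.continuous_fderiv (by simp))

theorem IsTestFunction.hasCompactSupport_gradient {φ : Euc N → ℝ} (hφ : IsTestFunction Ω φ) :
    HasCompactSupport (gradient φ) :=
  (hφ.compact.fderiv ℝ).comp_left (map_zero (InnerProductSpace.toDual ℝ (Euc N)).symm)

theorem inner_gradient (φ : Euc N → ℝ) (x v : Euc N) : ⟪gradient φ x, v⟫ = fderiv ℝ φ x v := by
  rw [gradient, InnerProductSpace.toDual_symm_apply]

theorem enorm_gradient (φ : Euc N → ℝ) (x : Euc N) : ‖gradient φ x‖ₑ = ‖fderiv ℝ φ x‖ₑ := by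
  rw [gradient, LinearIsometryEquiv.enorm_map]

/-- The element `(φ, ∇φ)` of the Sobolev space defined by a test function `φ`. -/
def testPair (q : Exponent Ω) : testSpace Ω →ₗ[ℝ] LpPair q where
  toFun φ := WithLp.toLp 1
    (⟨AEEqFun.mk φ.1 φ.2.smooth.continuous.aestronglyMeasurable,
      modular_mk_lt_top q φ.2.smooth.continuous φ.2.compact⟩,
    ⟨AEEqFun.mk (gradient φ.1) φ.2.continuous_gradient.aestronglyMeasurable,
      modular_mk_lt_top q φ.2.continuous_gradient φ.2.hasCompactSupport_gradient⟩)
  map_add' φ ψ := by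
    have h : gradient (φ.1 + ψ.1) = gradient φ.1 + gradient ψ.1 := by
      funext x
      simp only [gradient, Pi.add_apply,
        fderiv_add (φ.2.differentiable x) (ψ.2.differentiable x), map_add]
    refine congrArg (WithLp.toLp 1) (Prod.ext (Subtype.ext ?_) (Subtype.ext ?_))
    · rfl
    · simp only [Submodule.coe_add, h]
      rfl
  map_smul' a φ := by
    have h : gradient (a • φ.1) = a • gradient φ.1 := by
      funext x
      simp only [gradient, Pi.smul_apply, fderiv_const_smul (φ.2.differentiable x), map_smulₛₗ]
      rfl
    refine congrArg (WithLp.toLp 1) (Prod.ext (Subtype.ext ?_) (Subtype.ext ?_))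
    · rfl
    · simp only [SetLike.val_smul, h]
      rfl

theorem coeFn_testPair_fn (q : Exponent Ω) (φ : testSpace Ω) :
    (testPair q φ).fn =ᵐ[volume.restrict (Ω : Set (Euc N))] φ.1 :=
  AEEqFun.coeFn_mk _ _

theorem coeFn_testPair_grad (q : Exponent Ω) (φ : testSpace Ω) :
    (testPair q φ).grad =ᵐ[volume.restrict (Ω : Set (Euc N))] gradient φ.1 :=
  AEEqFun.coeFn_mk _ _

theorem isWeakGradient_gradient {φ : Euc N → ℝ} (hφ : IsTestFunction Ω φ) :
    IsWeakGradient Ω φ (gradient φ) := by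
  intro ψ hψ v
  have hdψ : Continuous fun x => fderiv ℝ ψ x v :=
    (hψ.smooth.continuous_fderiv (by simp)).clm_apply continuous_const
  have hdφ : Continuous fun x => fderiv ℝ φ x v :=
    (hφ.smooth.continuous_fderiv (by simp)).clm_apply continuous_const
  have hφc := hφ.smooth.continuous
  have hψc := hψ.smooth.continuous
  have h0 : ∀ x ∉ (Ω : Set (Euc N)), φ x = 0 := fun x hx =>
    image_eq_zero_of_notMem_tsupport fun h => hx (hφ.supp h)
  have h0' : ∀ x ∉ (Ω : Set (Euc N)), ψ x = 0 := fun x hx =>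
    image_eq_zero_of_notMem_tsupport fun h => hx (hψ.supp h)
  simp only [inner_gradient]
  rw [setIntegral_eq_integral_of_forall_compl_eq_zero (fun x hx => by rw [h0 x hx, zero_mul]),
    setIntegral_eq_integral_of_forall_compl_eq_zero (fun x hx => by rw [h0' x hx, mul_zero])]
  refine integral_mul_fderiv_eq_neg_fderiv_mul_of_integrable ?_ ?_ ?_
    (fun x _ => hφ.differentiable x) (fun x _ => hψ.differentiable x)
  · exact (hdφ.mul hψc).integrable_of_hasCompactSupport hψ.compact.mul_left
  · exact (hφc.mul hdψ).integrable_of_hasCompactSupport hφ.compact.mul_right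
  · exact (hφc.mul hψc).integrable_of_hasCompactSupport hφ.compact.mul_right

theorem IsWeakGradient.congr_ae {u u' : Euc N → ℝ} {G G' : Euc N → Euc N}
    (hu : u =ᵐ[volume.restrict (Ω : Set (Euc N))] u')
    (hG : G =ᵐ[volume.restrict (Ω : Set (Euc N))] G') (h : IsWeakGradient Ω u G) :
    IsWeakGradient Ω u' G' := by
  intro φ hφ v
  have h1 : (fun x => u x * fderiv ℝ φ x v) =ᵐ[volume.restrict (Ω : Set (Euc N))]
      fun x => u' x * fderiv ℝ φ x v := hu.mono fun x hx => by simp only [hx]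
  have h2 : (fun x => ⟪G x, v⟫ * φ x) =ᵐ[volume.restrict (Ω : Set (Euc N))]
      fun x => ⟪G' x, v⟫ * φ x := hG.mono fun x hx => by simp only [hx]
  rw [← integral_congr_ae h1, h φ hφ v, integral_congr_ae h2]

theorem testPair_mem_sobolev (q : Exponent Ω) (φ : testSpace Ω) : testPair q φ ∈ sobolev q :=
  (isWeakGradient_gradient φ.2).congr_ae (coeFn_testPair_fn q φ).symm (coeFn_testPair_grad q φ).symm

theorem testPair_mem_sobolevZero (q : Exponent Ω) (φ : testSpace Ω) :
    testPair q φ ∈ sobolevZero q :=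
  ⟨testPair_mem_sobolev q φ,
    subset_closure ⟨testPair_mem_sobolev q φ, φ.1, φ.2, coeFn_testPair_fn q φ⟩⟩

/-- Weak gradients are unique. -/
theorem IsWeakGradient.ae_eq {u : Euc N → ℝ} {G G' : Euc N → Euc N}
    (hG : IsWeakGradient Ω u G) (hG' : IsWeakGradient Ω u G')
    (hi : IntegrableOn G (Ω : Set (Euc N))) (hi' : IntegrableOn G' (Ω : Set (Euc N))) :
    G =ᵐ[volume.restrict (Ω : Set (Euc N))] G' := by
  have key : ∀ v : Euc N, ∀ᵐ x ∂(volume.restrict (Ω : Set (Euc N))), ⟪G x - G' x, v⟫ = 0 := by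
    intro v
    have hint : ∀ {H : Euc N → Euc N}, IntegrableOn H (Ω : Set (Euc N)) →
        IntegrableOn (fun x => ⟪H x, v⟫) (Ω : Set (Euc N)) := fun hH => hH.inner_const v
    have hdiff : IntegrableOn (fun x => ⟪G x - G' x, v⟫) (Ω : Set (Euc N)) := hint (hi.sub hi')
    rw [ae_restrict_iff' Ω.isOpen.measurableSet]
    refine Ω.isOpen.ae_eq_zero_of_integral_contDiff_smul_eq_zero hdiff.locallyIntegrableOn ?_
    intro g hg hgc hgs
    obtain ⟨C, hC⟩ := hgc.exists_bound_of_continuous hg.continuous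
    have hmul : ∀ {H : Euc N → Euc N}, IntegrableOn H (Ω : Set (Euc N)) →
        IntegrableOn (fun x => ⟪H x, v⟫ * g x) (Ω : Set (Euc N)) := fun hH =>
      (hint hH).mul_bdd hg.continuous.aestronglyMeasurable (ae_of_all _ hC)
    have h1 := hG g ⟨hg, hgc, hgs⟩ v
    have h2 := hG' g ⟨hg, hgc, hgs⟩ v
    rw [← setIntegral_eq_integral_of_forall_compl_eq_zero (s := (Ω : Set (Euc N))) fun x hx => by
      rw [image_eq_zero_of_notMem_tsupport fun h => hx (hgs h), zero_smul]]
    have h3 := integral_sub (hmul hi) (hmul hi')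
    rw [← neg_injective (h1.symm.trans h2), sub_self] at h3
    rw [← h3]
    refine integral_congr_ae (ae_of_all _ fun x => ?_)
    simp only [inner_sub_left, smul_eq_mul]
    ring
  have hall : ∀ᵐ x ∂(volume.restrict (Ω : Set (Euc N))), ∀ i : Fin N,
      ⟪G x - G' x, EuclideanSpace.single i (1 : ℝ)⟫ = 0 := ae_all_iff.2 fun i => key _
  filter_upwards [hall] with x hx
  rw [← sub_eq_zero]
  ext i
  simpa [EuclideanSpace.inner_single_right] using hx i

theorem integrableOn_of_modular_lt_top (hΩ : volume (Ω : Set (Euc N)) ≠ ⊤) (q : Exponent Ω)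
    {u : Euc N →ₘ[volume.restrict (Ω : Set (Euc N))] F} (hu : modular q u < ⊤) :
    IntegrableOn u (Ω : Set (Euc N)) := by
  refine ⟨u.aestronglyMeasurable, ?_⟩
  have h := lintegral_rpow_le_modular_add zero_le_one (fun x hx => q.one_le hx) u
  simp only [ENNReal.rpow_one] at h
  exact h.trans_lt (ENNReal.add_lt_top.2
    ⟨hu, ENNReal.mul_lt_top (ENNReal.natCast_lt_top N) hΩ.lt_top⟩)

/-- An element of the Sobolev space is determined by its underlying function. -/
theorem eq_testPair_of_ae_eq (hΩ : volume (Ω : Set (Euc N)) ≠ ⊤) {q : Exponent Ω} {w : LpPair q}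
    (hw : w ∈ sobolev q) (φ : testSpace Ω)
    (h : w.fn =ᵐ[volume.restrict (Ω : Set (Euc N))] φ.1) : w = testPair q φ := by
  have h1 : w.fn = (testPair q φ).fn := AEEqFun.ext (h.trans (coeFn_testPair_fn q φ).symm)
  have h2 : w.grad = (testPair q φ).grad := by
    refine AEEqFun.ext (IsWeakGradient.ae_eq hw ?_ (integrableOn_of_modular_lt_top hΩ q w.snd.2)
      (integrableOn_of_modular_lt_top hΩ q (testPair q φ).snd.2))
    rw [h1]
    exact testPair_mem_sobolev q φ
  exact WithLp.ofLp_injective 1 (Prod.ext (Subtype.ext h1) (Subtype.ext h2))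

/-- Uniqueness of weak gradients identifies the dense set in the definition with the range of a
linear map, the form needed for finite-dimensional approximation. -/
theorem sobolevZero_subset_closure_range (hΩ : volume (Ω : Set (Euc N)) ≠ ⊤) (q : Exponent Ω) :
    sobolevZero q ⊆ closure (range (testPair q)) := by
  refine inter_subset_right.trans (closure_mono ?_)
  rintro w ⟨hw, φ, hφ, h⟩
  exact ⟨⟨φ, hφ⟩, (eq_testPair_of_ae_eq hΩ hw ⟨φ, hφ⟩ h).symm⟩

end TestFunctions

/-! ### Genus and odd approximation. -/

section Genus

theorem genus_le_of_odd_map {V W : Type*} [TopologicalSpace V] [Neg V] [TopologicalSpace W] [Neg W]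
    {K : Set V} {A : Set W} {c : V → W} (hc : ContinuousOn c K) (hKA : MapsTo c K A)
    (hodd : ∀ u ∈ K, c (-u) = -c u) : genus K ≤ genus A := by
  refine le_iInf₂ fun k ⟨f, hf, hfA⟩ => iInf₂_le k ⟨f ∘ c, hf.comp hc hKA, fun u hu => ?_⟩
  have h := hfA (c u) (hKA hu)
  exact ⟨by rw [Function.comp_apply, hodd u hu, h.1, Function.comp_apply], h.2⟩

/-- An odd continuous approximation of the identity of a symmetric compact set, with values in a
finite-dimensional space spanned by elements of a given dense subspace. -/
theorem exists_odd_approximation {V E : Type*} [AddCommGroup V] [Module ℝ V]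
    [NormedAddCommGroup E] [NormedSpace ℝ E] (T : V →ₗ[ℝ] E) {K : Set E} (hK : IsCompact K)
    (hT : K ⊆ closure (range T)) {ε : ℝ} (hε : 0 < ε) :
    ∃ (t : Finset V) (c : E → t → ℝ), ContinuousOn c K ∧ (∀ u, c (-u) = -c u) ∧
      ∀ u ∈ K, ‖u - T (Fintype.linearCombination ℝ (fun i : t => (i : V)) (c u))‖ ≤ ε := by
  obtain ⟨t, ht⟩ := hK.elim_finite_subcover (fun φ : V => Metric.ball (T φ) ε)
    (fun _ => Metric.isOpen_ball) (fun u hu => by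
      obtain ⟨_, ⟨φ, rfl⟩, h⟩ := Metric.mem_closure_iff.1 (hT hu) ε hε
      exact mem_iUnion.2 ⟨φ, h⟩)
  -- Hat functions supported in the covering balls. Antisymmetrising the weights and dividing by the
  -- even sum `S` makes the coefficients odd.
  let θ : t → E → ℝ := fun i u => max 0 (ε - ‖u - T i‖)
  let S : E → ℝ := fun u => ∑ i, (θ i u + θ i (-u))
  have hθc : ∀ i, Continuous (θ i) := fun i => by fun_prop
  have hθ0 : ∀ i u, 0 ≤ θ i u := fun i u => le_max_left _ _
  have hSc : Continuous S := by fun_prop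
  have hSneg : ∀ u, S (-u) = S u := fun u => by
    simp only [S, neg_neg]
    exact Finset.sum_congr rfl fun i _ => add_comm _ _
  have hSpos : ∀ u ∈ K, 0 < S u := by
    intro u hu
    obtain ⟨φ, hφt, hφ⟩ := mem_iUnion₂.1 (ht hu)
    refine Finset.sum_pos' (fun i _ => add_nonneg (hθ0 i u) (hθ0 i (-u)))
      ⟨⟨φ, hφt⟩, Finset.mem_univ _, add_pos_of_pos_of_nonneg (lt_max_of_lt_right ?_) (hθ0 _ _)⟩
    rw [Metric.mem_ball, dist_eq_norm] at hφ
    exact sub_pos.2 hφ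
  have hθn : ∀ i u, θ i u * ‖u - T i‖ ≤ θ i u * ε := by
    intro i u
    rcases le_or_gt ‖u - T i‖ ε with h | h
    · exact mul_le_mul_of_nonneg_left h (hθ0 i u)
    · have : θ i u = 0 := max_eq_left (by linarith)
      simp [this]
  refine ⟨t, fun u i => (S u)⁻¹ * (θ i u - θ i (-u)), ?_, ?_, ?_⟩
  · refine continuousOn_pi.2 fun i => ?_
    refine ContinuousOn.mul (hSc.continuousOn.inv₀ fun u hu => (hSpos u hu).ne') ?_
    exact ((hθc i).sub ((hθc i).comp continuous_neg)).continuousOn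
  · intro u
    funext i
    simp only [hSneg, neg_neg, Pi.neg_apply]
    ring
  · intro u hu
    have hS := hSpos u hu
    -- The error is an average of the vectors `u - T i` and `-(-u - T i)`; a term has nonzero weight
    -- only if its vector has norm below `ε`.
    have key : u - T (Fintype.linearCombination ℝ (fun i : t => (i : V))
        fun i => (S u)⁻¹ * (θ i u - θ i (-u))) =
        (S u)⁻¹ • ∑ i : t, (θ i u • (u - T i) - θ i (-u) • (-u - T i)) := by
      have h1 : ∑ i : t, (θ i u • (u - T i) - θ i (-u) • (-u - T i)) =
          S u • u - ∑ i : t, (θ i u - θ i (-u)) • T i := by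
        rw [Finset.sum_smul, ← Finset.sum_sub_distrib]
        refine Finset.sum_congr rfl fun i _ => ?_
        module
      rw [h1, smul_sub, smul_smul, inv_mul_cancel₀ hS.ne', one_smul, Finset.smul_sum,
        Fintype.linearCombination_apply, map_sum]
      congr 1
      refine Finset.sum_congr rfl fun i _ => ?_
      rw [map_smul, mul_smul]
    rw [key, norm_smul, norm_inv, Real.norm_of_nonneg hS.le, inv_mul_le_iff₀ hS, Finset.sum_mul]
    refine norm_sum_le_of_le _ fun i _ => (norm_sub_le _ _).trans ?_
    rw [norm_smul, norm_smul, Real.norm_of_nonneg (hθ0 _ _), Real.norm_of_nonneg (hθ0 _ _), add_mul]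
    exact add_le_add (hθn i u) (hθn i (-u))

end Genus

/-! ### Reduction of the minimax to finite-dimensional sets of test functions. -/

section FiniteDimensional

variable {N : ℕ} {Ω : Opens (Euc N)}

theorem LpPair.norm_fst_le {q : Exponent Ω} (w : LpPair q) : ‖w.fst‖ ≤ ‖w‖ := by
  rw [WithLp.prod_norm_eq_of_L1]
  exact le_add_of_nonneg_right (norm_nonneg _)

theorem LpPair.norm_snd_le {q : Exponent Ω} (w : LpPair q) : ‖w.snd‖ ≤ ‖w‖ := by
  rw [WithLp.prod_norm_eq_of_L1]
  exact le_add_of_nonneg_left (norm_nonneg _)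

theorem exists_finite_of_eigenvalue_lt (hΩ : volume (Ω : Set (Euc N)) ≠ ⊤) {q : Exponent Ω} {m : ℕ}
    {a : ℝ} (h : eigenvalue q m < ENNReal.ofReal a) :
    ∃ (t : Finset (testSpace Ω)) (A : Set (t → ℝ)), IsCompact A ∧ (∀ c ∈ A, -c ∈ A) ∧
      m ≤ genus A ∧ ∀ c ∈ A,
        ‖(testPair q (Fintype.linearCombination ℝ (fun i : t => (i : testSpace Ω)) c)).snd‖ <
          a * ‖(testPair q (Fintype.linearCombination ℝ (fun i : t => (i : testSpace Ω)) c)).fst‖ := by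
  obtain ⟨K, ⟨hKc, hKs, hKsub, hKg⟩, hKa⟩ := by simpa only [eigenvalue, iInf_lt_iff] using h
  obtain ⟨b, hb0, hKb, hba⟩ := ENNReal.lt_iff_exists_real_btwn.1 hKa
  have hba' : b < a := (ENNReal.ofReal_lt_ofReal_iff_of_nonneg hb0).1 hba
  have hKb' : ∀ u ∈ K, ‖u.snd‖ ≤ b := fun u hu =>
    (ENNReal.ofReal_le_ofReal_iff hb0).1
      ((le_iSup₂ (f := fun (u : LpPair q) (_ : u ∈ K) => ENNReal.ofReal ‖u.snd‖) u hu).trans hKb.le)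
  have ha : 0 < a := hb0.trans_lt hba'
  -- This `ε` satisfies `ε(1 + a) = (a - b)/2 < a - b`, that is, `b + ε < a(1 - ε)`.
  have hε : 0 < (a - b) / (2 * (1 + a)) := div_pos (sub_pos.2 hba') (by positivity)
  obtain ⟨t, c, hc, hodd, happ⟩ := exists_odd_approximation (testPair q) hKc
    (fun u hu => sobolevZero_subset_closure_range hΩ q (hKsub hu).1) hε
  refine ⟨t, c '' K, hKc.image_of_continuousOn hc, ?_,
    hKg.trans (genus_le_of_odd_map hc (mapsTo_image c K) fun u _ => hodd u), ?_⟩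
  · rintro _ ⟨u, hu, rfl⟩
    exact ⟨-u, hKs u hu, hodd u⟩
  · rintro _ ⟨u, hu, rfl⟩
    set w := testPair q (Fintype.linearCombination ℝ (fun i : t => (i : testSpace Ω)) (c u))
    have h1 := (LpPair.norm_fst_le (u - w)).trans (happ u hu)
    have h2 := (LpPair.norm_snd_le (u - w)).trans (happ u hu)
    rw [WithLp.sub_fst] at h1
    rw [WithLp.sub_snd] at h2
    have hu1 : ‖u.fst‖ = 1 := (hKsub hu).2
    have h3 : 1 - (a - b) / (2 * (1 + a)) ≤ ‖w.fst‖ := by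
      have := norm_sub_norm_le u.fst w.fst
      linarith
    have h4 : ‖w.snd‖ ≤ b + (a - b) / (2 * (1 + a)) := by
      have := norm_sub_norm_le w.snd u.snd
      rw [norm_sub_rev] at this
      have := hKb' u hu
      linarith
    refine h4.trans_lt (lt_of_lt_of_le ?_ (mul_le_mul_of_nonneg_left h3 ha.le))
    have h5 : (a - b) / (2 * (1 + a)) * (2 * (1 + a)) = a - b := div_mul_cancel₀ _ (by positivity)
    nlinarith

/-- The strict inequality keeps `‖φ‖` away from zero on `A`, so normalisation is an odd continuous
map into the unit sphere and cannot lower the genus. -/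
theorem eigenvalue_le_of_finite {q : Exponent Ω} {m : ℕ} {a : ℝ} {ι : Type*} [Fintype ι]
    (T : (ι → ℝ) →ₗ[ℝ] testSpace Ω) {A : Set (ι → ℝ)} (hA : IsCompact A) (hneg : ∀ c ∈ A, -c ∈ A)
    (hg : m ≤ genus A)
    (h : ∀ c ∈ A, ‖(testPair q (T c)).snd‖ < a * ‖(testPair q (T c)).fst‖) :
    eigenvalue q m ≤ ENNReal.ofReal a := by
  have hcont : Continuous fun c => testPair q (T c) :=
    ((testPair q).comp T).continuous_of_finiteDimensional
  have hfst : Continuous fun c => (testPair q (T c)).fst := WithLp.continuous_fst 1 _ _ |>.comp hcont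
  have hne : ∀ c ∈ A, ‖(testPair q (T c)).fst‖ ≠ 0 := fun c hc h0 => by
    have := h c hc
    rw [h0, mul_zero] at this
    exact absurd this (norm_nonneg _).not_gt
  let f : (ι → ℝ) → LpPair q := fun c => ‖(testPair q (T c)).fst‖⁻¹ • testPair q (T c)
  have hf : ContinuousOn f A :=
    (hfst.norm.continuousOn.inv₀ hne).smul hcont.continuousOn
  have hodd : ∀ c, f (-c) = -f c := fun c => by
    simp only [f, map_neg, WithLp.neg_fst, norm_neg, smul_neg]
  have hmem : f '' A ∈ minimaxSets q m := by
    refine ⟨hA.image_of_continuousOn hf, ?_, ?_,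
      hg.trans (genus_le_of_odd_map hf (mapsTo_image f A) fun c _ => hodd c)⟩
    · rintro _ ⟨c, hc, rfl⟩
      exact ⟨-c, hneg c hc, hodd c⟩
    · rintro _ ⟨c, hc, rfl⟩
      refine ⟨?_, ?_⟩
      · simp only [f, ← map_smul]
        exact testPair_mem_sobolevZero q _
      · simp only [f, WithLp.smul_fst, norm_smul, norm_inv, norm_norm]
        exact inv_mul_cancel₀ (hne c hc)
  refine (iInf₂_le (f '' A) hmem).trans (iSup₂_le ?_)
  rintro _ ⟨c, hc, rfl⟩
  refine ENNReal.ofReal_le_ofReal ?_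
  have hpos : 0 < ‖(testPair q (T c)).fst‖ := (norm_nonneg _).lt_of_ne' (hne c hc)
  simp only [f, WithLp.smul_snd, norm_smul, norm_inv, norm_norm]
  rw [inv_mul_le_iff₀ hpos, mul_comm]
  exact (h c hc).le

end FiniteDimensional

/-! ### Convergence of norms, and Sobolev bounds uniform in the exponent. -/

section Convergence

variable {N : ℕ} {Ω : Opens (Euc N)}

theorem lintegral_smul_rpow {F : Type*} [NormedAddCommGroup F] [NormedSpace ℝ F] {s : ℝ}
    (hs : 0 ≤ s) (a : ℝ) (u : Euc N →ₘ[volume.restrict (Ω : Set (Euc N))] F) :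
    ∫⁻ x in (Ω : Set (Euc N)), ‖(a • u : Euc N →ₘ[volume.restrict (Ω : Set (Euc N))] F) x‖ₑ ^ s =
      ‖a‖ₑ ^ s * ∫⁻ x in (Ω : Set (Euc N)), ‖u x‖ₑ ^ s := by
  rw [← lintegral_const_mul' _ _ (ENNReal.rpow_ne_top_of_nonneg hs enorm_ne_top)]
  refine lintegral_congr_ae ((AEEqFun.coeFn_smul a u).mono fun x hx => ?_)
  simp only [hx, Pi.smul_apply, enorm_smul, ENNReal.mul_rpow_of_nonneg _ _ hs]

/-- Luxemburg norms depend continuously on the exponent. -/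
theorem VarLp.tendsto_norm {F : Type*} [NormedAddCommGroup F] [NormedSpace ℝ F]
    (hΩ : volume (Ω : Set (Euc N)) ≠ ⊤) {p : Exponent Ω} {q : ℕ → Exponent Ω} {S s : ℝ}
    (hunif : ∀ δ > 0, ∀ᶠ h in atTop, ∀ x ∈ Ω, q h x - p x ≤ δ)
    (hle : ∀ h, ∀ x ∈ Ω, p x ≤ q h x) (hS : ∀ᶠ h in atTop, ∀ x ∈ Ω, q h x ≤ S) (hs0 : 0 ≤ s)
    (hs : S < s) (u : VarLp p F) (w : ∀ h, VarLp (q h) F)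
    (huw : ∀ h, (u : Euc N →ₘ[volume.restrict (Ω : Set (Euc N))] F) = w h)
    (hint : ∫⁻ x in (Ω : Set (Euc N)),
      ‖(u : Euc N →ₘ[volume.restrict (Ω : Set (Euc N))] F) x‖ₑ ^ s ≠ ⊤) :
    Tendsto (fun h => ‖w h‖) atTop (𝓝 ‖u‖) := by
  refine tendsto_order.2 ⟨fun l hl => ?_, fun l hl => ?_⟩
  · have hlim : Tendsto (fun δ : ℝ => (1 + δ * volume.real (Ω : Set (Euc N))) * l) (𝓝[>] 0)
        (𝓝 l) := by
      have : Continuous fun δ : ℝ => (1 + δ * volume.real (Ω : Set (Euc N))) * l := by fun_prop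
      simpa using (this.tendsto 0).mono_left nhdsWithin_le_nhds
    obtain ⟨δ, hδl, hδ⟩ := ((hlim.eventually_lt_const hl).and self_mem_nhdsWithin).exists
    have hδ0 : 0 < δ := hδ
    filter_upwards [hunif δ hδ0] with h hh
    have h1 := VarLp.norm_le_of_exponent_le hδ0.le hΩ (hle h) hh u (w h) (huw h)
    exact lt_of_mul_lt_mul_left (hδl.trans_le h1) (by positivity)
  · obtain ⟨c, huc, hcl⟩ := exists_between hl
    have hfin : ∫⁻ x in (Ω : Set (Euc N)), ‖(c⁻¹ • (u : Euc N →ₘ[volume.restrict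
        (Ω : Set (Euc N))] F) : Euc N →ₘ[volume.restrict (Ω : Set (Euc N))] F) x‖ₑ ^ s ≠ ⊤ := by
      rw [lintegral_smul_rpow hs0]
      exact ENNReal.mul_ne_top (ENNReal.rpow_ne_top_of_nonneg hs0 enorm_ne_top) hint
    set B := ∫⁻ x in (Ω : Set (Euc N)), ‖(c⁻¹ • (u : Euc N →ₘ[volume.restrict
        (Ω : Set (Euc N))] F) : Euc N →ₘ[volume.restrict (Ω : Set (Euc N))] F) x‖ₑ ^ s
    have hlim : Tendsto (fun δ : ℝ => c * (1 + δ / (s - S) * B.toReal)) (𝓝[>] 0) (𝓝 c) := by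
      have : Continuous fun δ : ℝ => c * (1 + δ / (s - S) * B.toReal) := by fun_prop
      simpa using (this.tendsto 0).mono_left nhdsWithin_le_nhds
    obtain ⟨δ, hδl, hδ⟩ := ((hlim.eventually_lt_const hcl).and self_mem_nhdsWithin).exists
    have hδ0 : 0 < δ := hδ
    filter_upwards [hunif δ hδ0, hS] with h hh hhS
    exact (VarLp.norm_le_of_lintegral_le hδ0.le (hle h) hh hhS hs u (w h) (huw h) huc
      ENNReal.toReal_nonneg (ENNReal.ofReal_toReal hfin).ge).trans_lt hδl

/-- Pointwise convergence of seminorms on a finite-dimensional space is locally uniform. -/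
theorem tendsto_seminorm_prod {ι : Type*} [Fintype ι] (n : ℕ → Seminorm ℝ (ι → ℝ))
    (n₀ : Seminorm ℝ (ι → ℝ)) (h : ∀ c, Tendsto (fun k => n k c) atTop (𝓝 (n₀ c))) (c : ι → ℝ) :
    Tendsto (fun z : ℕ × (ι → ℝ) => n z.1 z.2) (atTop ×ˢ 𝓝 c) (𝓝 (n₀ c)) := by
  classical
  -- The values on the basis vectors converge, so this bound makes the seminorms equicontinuous at
  -- `c`.
  have hbound : ∀ k (d : ι → ℝ), n k d ≤ ∑ i, |d i| * n k (Pi.single i 1) := by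
    intro k d
    conv_lhs => rw [pi_eq_sum_univ' d]
    refine (Finset.le_sum_of_subadditive (n k) (map_zero (n k)).le (map_add_le_add _) _ _).trans ?_
    refine Finset.sum_le_sum fun i _ => ?_
    rw [map_smul_eq_mul, Real.norm_eq_abs]
  have hzero : Tendsto (fun z : ℕ × (ι → ℝ) => ∑ i, |(z.2 - c) i| * n z.1 (Pi.single i 1))
      (atTop ×ˢ 𝓝 c) (𝓝 0) := by
    have : ∀ i, Tendsto (fun z : ℕ × (ι → ℝ) => |(z.2 - c) i| * n z.1 (Pi.single i 1))
        (atTop ×ˢ 𝓝 c) (𝓝 (0 * n₀ (Pi.single i 1))) := fun i => by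
      refine Tendsto.mul ?_ ((h _).comp tendsto_fst)
      have hc : Continuous fun d : ι → ℝ => |(d - c) i| := by fun_prop
      simpa [Function.comp_def] using (hc.tendsto c).comp (tendsto_snd (f := (atTop : Filter ℕ)))
    simpa using tendsto_finsetSum Finset.univ fun i _ => this i
  have hdist : Tendsto (fun z : ℕ × (ι → ℝ) => n z.1 z.2 - n z.1 c) (atTop ×ˢ 𝓝 c) (𝓝 0) := by
    refine squeeze_zero_norm (fun z => ?_) hzero
    rw [Real.norm_eq_abs]
    exact (abs_sub_map_le_sub (n z.1) z.2 c).trans (hbound z.1 (z.2 - c))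
  simpa using hdist.add ((h c).comp tendsto_fst)

theorem lintegral_rpow_ne_top_of_hasCompactSupport {F : Type*} [NormedAddCommGroup F] {f : Euc N → F}
    (hf : Continuous f) (hc : HasCompactSupport f) {s : ℝ} (hs : 0 < s)
    {u : Euc N →ₘ[volume.restrict (Ω : Set (Euc N))] F}
    (hu : u =ᵐ[volume.restrict (Ω : Set (Euc N))] f) :
    ∫⁻ x in (Ω : Set (Euc N)), ‖u x‖ₑ ^ s ≠ ⊤ := by
  rw [lintegral_congr_ae (hu.mono fun x hx => by simp only [hx] :
    (fun x => ‖u x‖ₑ ^ s) =ᵐ[volume.restrict (Ω : Set (Euc N))] fun x => ‖f x‖ₑ ^ s)]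
  have h := (hf.memLp_of_hasCompactSupport (μ := volume.restrict (Ω : Set (Euc N)))
    (p := ENNReal.ofReal s) hc).2
  have h2 := lintegral_rpow_enorm_lt_top_of_eLpNorm_lt_top (by simpa using hs)
    ENNReal.ofReal_ne_top h
  rw [ENNReal.toReal_ofReal hs.le] at h2
  exact h2.ne

variable (Ω) in
/-- The Gagliardo–Nirenberg–Sobolev inequality on `C_c^∞(Ω)`. -/
theorem exists_sobolev_bound {r : ℝ} (hr : 1 ≤ r) (hrN : r < N) :
    ∃ C : NNReal, ∀ φ : testSpace Ω,
      ∫⁻ x in (Ω : Set (Euc N)), ‖φ.1 x‖ₑ ^ (N * r / (N - r)) ≤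
        (C * (∫⁻ x in (Ω : Set (Euc N)), ‖gradient φ.1 x‖ₑ ^ r) ^ (1 / r)) ^ (N * r / (N - r)) := by
  have hr0 : 0 < r := by linarith
  have hN0 : (0 : ℝ) < N := by linarith
  have hNr : 0 < N - r := sub_pos.2 hrN
  set s : ℝ := N * r / (N - r) with hsdef
  have hs0 : 0 < s := by positivity
  refine ⟨eLpNormLESNormFDerivOfEqInnerConst (volume : Measure (Euc N)) r, fun φ => ?_⟩
  have hgns := eLpNorm_le_eLpNorm_fderiv_of_eq_inner (volume : Measure (Euc N))
    (φ.2.smooth.of_le (by simp)) φ.2.compact (p := r.toNNReal) (p' := s.toNNReal)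
    (by simpa using hr) (by simpa using (Nat.cast_pos (α := ℝ)).1 hN0) (by
      rw [NNReal.coe_inv, Real.coe_toNNReal _ hs0.le, Real.coe_toNNReal _ hr0.le, finrank_euclideanSpace_fin,
        hsdef]
      field_simp)
  have hr1 : (r.toNNReal : ℝ≥0∞) ≠ 0 := by simpa using hr0
  have hs1 : (s.toNNReal : ℝ≥0∞) ≠ 0 := by simpa using hs0
  rw [eLpNorm_eq_lintegral_rpow_enorm_toReal hr1 ENNReal.coe_ne_top,
    eLpNorm_eq_lintegral_rpow_enorm_toReal hs1 ENNReal.coe_ne_top, ENNReal.coe_toReal,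
    ENNReal.coe_toReal, Real.coe_toNNReal _ hs0.le, Real.coe_toNNReal _ hr0.le] at hgns
  have hgrad : ∫⁻ x in (Ω : Set (Euc N)), ‖gradient φ.1 x‖ₑ ^ r = ∫⁻ x, ‖fderiv ℝ φ.1 x‖ₑ ^ r := by
    simp only [← enorm_gradient]
    rw [← lintegral_indicator Ω.isOpen.measurableSet]
    congr 1
    refine indicator_eq_self.2 fun x hx => ?_
    by_contra hxΩ
    refine hx ?_
    have : fderiv ℝ φ.1 x = 0 := image_eq_zero_of_notMem_tsupport fun h =>
      hxΩ (φ.2.supp (tsupport_fderiv_subset ℝ h))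
    simp [gradient, this, hr0]
  rw [hgrad]
  refine (setLIntegral_le_lintegral _ _).trans ?_
  rw [one_div, ENNReal.rpow_inv_le_iff hs0] at hgns
  exact hgns

/-- Functions with bounded gradient in `L^{q(x)}` are bounded in `L^s`, uniformly in `q ≥ r`, where
`s` is the critical exponent of `r`. -/
theorem exists_uniform_lintegral_bound (hΩ : volume (Ω : Set (Euc N)) ≠ ⊤) {r : ℝ} (hr : 1 ≤ r)
    (hrN : r < N) :
    ∃ B : ℝ, 0 ≤ B ∧ ∀ q : Exponent Ω, (∀ x ∈ Ω, r ≤ q x) → ∀ (φ : testSpace Ω) (a : ℝ),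
      ‖(testPair q φ).snd‖ < a →
      ∫⁻ x in (Ω : Set (Euc N)), ‖(a⁻¹ • (testPair q φ).fn :
        Euc N →ₘ[volume.restrict (Ω : Set (Euc N))] ℝ) x‖ₑ ^ (N * r / (N - r)) ≤
          ENNReal.ofReal B := by
  obtain ⟨C, hC⟩ := exists_sobolev_bound Ω hr hrN
  have hr0 : 0 < r := by linarith
  have hs0 : 0 ≤ N * r / (N - r) := div_nonneg (by positivity) (sub_nonneg.2 hrN.le)
  have hfin : (C * (1 + N * volume (Ω : Set (Euc N))) ^ (1 / r)) ^ (N * r / (N - r)) ≠ ⊤ := by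
    refine ENNReal.rpow_ne_top_of_nonneg hs0 (ENNReal.mul_ne_top ENNReal.coe_ne_top ?_)
    refine ENNReal.rpow_ne_top_of_nonneg (by positivity) (ENNReal.add_ne_top.2 ⟨by simp, ?_⟩)
    exact ENNReal.mul_ne_top (ENNReal.natCast_ne_top N) hΩ
  refine ⟨((C * (1 + N * volume (Ω : Set (Euc N))) ^ (1 / r)) ^ (N * r / (N - r))).toReal,
    ENNReal.toReal_nonneg, fun q hq φ a ha => ?_⟩
  rw [ENNReal.ofReal_toReal hfin]
  -- After division by `a` the gradient has modular at most `1`, so its `L^r` integral is at most `1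
  -- + N|Ω|`, whatever `q` is.
  have hmod : modular q (testPair q (a⁻¹ • φ)).grad ≤ 1 := by
    rw [map_smul]
    exact VarLp.modular_le_one_of_norm_lt _ ha
  have hgrad := lintegral_rpow_le_modular_add hr0.le hq (testPair q (a⁻¹ • φ)).grad
  rw [lintegral_congr_ae ((coeFn_testPair_grad q (a⁻¹ • φ)).mono fun x hx => by simp only [hx] :
    (fun x => ‖(testPair q (a⁻¹ • φ)).grad x‖ₑ ^ r) =ᵐ[volume.restrict (Ω : Set (Euc N))]
      fun x => ‖gradient (a⁻¹ • φ).1 x‖ₑ ^ r)] at hgrad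
  have hfn : a⁻¹ • (testPair q φ).fn = (testPair q (a⁻¹ • φ)).fn := by
    rw [map_smul]
    rfl
  rw [hfn, lintegral_congr_ae ((coeFn_testPair_fn q (a⁻¹ • φ)).mono fun x hx => by simp only [hx] :
    (fun x => ‖(testPair q (a⁻¹ • φ)).fn x‖ₑ ^ (N * r / (N - r)))
      =ᵐ[volume.restrict (Ω : Set (Euc N))] fun x => ‖(a⁻¹ • φ).1 x‖ₑ ^ (N * r / (N - r)))]
  refine (hC _).trans ?_
  gcongr
  exact hgrad.trans (by gcongr)

end Convergence

/-! ### The two one-sided bounds on the eigenvalues. -/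

section Eigenvalues

variable {N : ℕ} {Ω : Opens (Euc N)}

/-- A bound on the Rayleigh quotient of a test function for the exponent `q` gives one for an
exponent `p ≤ q` close to `q`. -/
theorem norm_snd_le_of_norm_snd_lt {p q : Exponent Ω} (hΩ : volume (Ω : Set (Euc N)) ≠ ⊤)
    {S s δ B a : ℝ} (hs0 : 0 ≤ s) (hs : S < s) (hB : 0 ≤ B) (hδ0 : 0 ≤ δ)
    (hpq : ∀ x ∈ Ω, p x ≤ q x) (hδ : ∀ x ∈ Ω, q x - p x ≤ δ) (hS : ∀ x ∈ Ω, q x ≤ S)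
    (hbound : ∀ (φ : testSpace Ω) (a : ℝ), ‖(testPair q φ).snd‖ < a →
      ∫⁻ x in (Ω : Set (Euc N)), ‖(a⁻¹ • (testPair q φ).fn :
        Euc N →ₘ[volume.restrict (Ω : Set (Euc N))] ℝ) x‖ₑ ^ s ≤ ENNReal.ofReal B)
    (hκ : δ / (s - S) * ((2 * a) ^ s * B) < 1) (φ : testSpace Ω)
    (hφ : ‖(testPair q φ).snd‖ < a * ‖(testPair q φ).fst‖) :
    ‖(testPair q φ).fst‖ ≤
        ‖(testPair p φ).fst‖ * (1 + δ / (s - S) * ((2 * a) ^ s * B)) ∧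
      ‖(testPair p φ).snd‖ ≤
        (1 + δ * volume.real (Ω : Set (Euc N))) * ‖(testPair q φ).snd‖ := by
  refine ⟨?_, VarLp.norm_le_of_exponent_le hδ0 hΩ hpq hδ _ _ rfl⟩
  set d := ‖(testPair q φ).fst‖
  set κ := δ / (s - S) * ((2 * a) ^ s * B)
  have had : 0 < a * d := (norm_nonneg _).trans_lt hφ
  have hd : 0 < d := (norm_nonneg _).lt_of_ne' fun h0 => by simp [d, h0] at had
  have ha : 0 < a := pos_of_mul_pos_left had hd.le
  have hκ0 : 0 ≤ κ := mul_nonneg (div_nonneg hδ0 (sub_pos.2 hs).le) (by positivity)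
  -- The floor `d / 2` gives `a * d / c ≤ 2 * a`, which bounds `φ / c` in `L^s` before any lower
  -- bound on `‖φ‖_p` is known.
  have key : ∀ c, max ‖(testPair p φ).fst‖ (d / 2) < c → d ≤ c * (1 + κ) := by
    intro c hc
    obtain ⟨hc1, hc2⟩ := max_lt_iff.1 hc
    have hc0 : 0 < c := (by positivity : 0 < d / 2).trans hc2
    refine VarLp.norm_le_of_lintegral_le hδ0 hpq hδ hS hs (testPair p φ).fst (testPair q φ).fst rfl
      hc1 (by positivity) ?_
    have heq : c⁻¹ • (testPair p φ).fn = (a * d / c) • ((a * d)⁻¹ • (testPair q φ).fn) := by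
      rw [smul_smul, div_mul_eq_mul_div, mul_inv_cancel₀ had.ne', one_div]
      rfl
    rw [heq, lintegral_smul_rpow hs0, ENNReal.ofReal_mul (by positivity),
      ← ENNReal.ofReal_rpow_of_nonneg (by positivity) hs0]
    gcongr
    · rw [Real.enorm_of_nonneg (by positivity)]
      refine ENNReal.ofReal_le_ofReal ((div_le_iff₀ hc0).2 ?_)
      nlinarith
    · exact hbound φ (a * d) hφ
  have hlim : Tendsto (fun c => c * (1 + κ)) (𝓝[>] max ‖(testPair p φ).fst‖ (d / 2))
      (𝓝 (max ‖(testPair p φ).fst‖ (d / 2) * (1 + κ))) :=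
    ((continuous_id.mul continuous_const).tendsto _).mono_left nhdsWithin_le_nhds
  have hmax := ge_of_tendsto hlim (eventually_nhdsWithin_of_forall key)
  -- If the floor were the maximum, then `d ≤ (d / 2)(1 + κ)`, which `κ < 1` and `d > 0` exclude.
  rcases le_total ‖(testPair p φ).fst‖ (d / 2) with h | h
  · rw [max_eq_right h] at hmax
    nlinarith
  · rwa [max_eq_left h] at hmax

/-- The seminorm `φ ↦ ‖φ‖_{q(x)}` on test functions. -/
def fstSeminorm (q : Exponent Ω) : Seminorm ℝ (testSpace Ω) :=
  (normSeminorm ℝ (VarLp q ℝ)).comp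
    (LinearMap.fst ℝ _ _ ∘ₗ (WithLp.linearEquiv 1 ℝ _).toLinearMap ∘ₗ testPair q)

/-- The seminorm `φ ↦ ‖∇φ‖_{q(x)}` on test functions. -/
def sndSeminorm (q : Exponent Ω) : Seminorm ℝ (testSpace Ω) :=
  (normSeminorm ℝ (VarLp q (Euc N))).comp
    (LinearMap.snd ℝ _ _ ∘ₗ (WithLp.linearEquiv 1 ℝ _).toLinearMap ∘ₗ testPair q)

theorem eventually_eigenvalue_le (hΩ : volume (Ω : Set (Euc N)) ≠ ⊤) {m : ℕ} {p : Exponent Ω}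
    {q : ℕ → Exponent Ω} {S s : ℝ} (hunif : ∀ δ > 0, ∀ᶠ h in atTop, ∀ x ∈ Ω, q h x - p x ≤ δ)
    (hle : ∀ h, ∀ x ∈ Ω, p x ≤ q h x) (hS : ∀ᶠ h in atTop, ∀ x ∈ Ω, q h x ≤ S) (hs0 : 0 < s)
    (hs : S < s) {a : ℝ} (ha : eigenvalue p m < ENNReal.ofReal a) :
    ∀ᶠ h in atTop, eigenvalue (q h) m ≤ ENNReal.ofReal a := by
  obtain ⟨t, A, hA, hneg, hg, hlt⟩ := exists_finite_of_eigenvalue_lt hΩ ha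
  set T := Fintype.linearCombination ℝ (fun i : t => (i : testSpace Ω))
  have hfst : ∀ φ, Tendsto (fun h => fstSeminorm (q h) φ) atTop (𝓝 (fstSeminorm p φ)) := fun φ =>
    VarLp.tendsto_norm hΩ hunif hle hS hs0.le hs (testPair p φ).fst (fun h => (testPair (q h) φ).fst)
      (fun _ => rfl) (lintegral_rpow_ne_top_of_hasCompactSupport φ.2.smooth.continuous φ.2.compact hs0
        (coeFn_testPair_fn p φ))
  have hsnd : ∀ φ, Tendsto (fun h => sndSeminorm (q h) φ) atTop (𝓝 (sndSeminorm p φ)) := fun φ =>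
    VarLp.tendsto_norm hΩ hunif hle hS hs0.le hs (testPair p φ).snd (fun h => (testPair (q h) φ).snd)
      (fun _ => rfl) (lintegral_rpow_ne_top_of_hasCompactSupport φ.2.continuous_gradient
        φ.2.hasCompactSupport_gradient hs0 (coeFn_testPair_grad p φ))
  have hev : ∀ c ∈ A, ∀ᶠ z : ℕ × (t → ℝ) in atTop ×ˢ 𝓝 c,
      sndSeminorm (q z.1) (T z.2) < a * fstSeminorm (q z.1) (T z.2) := fun c hc =>
    (tendsto_seminorm_prod (fun h => (sndSeminorm (q h)).comp T) ((sndSeminorm p).comp T)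
      (fun c => hsnd (T c)) c).eventually_lt
      ((tendsto_seminorm_prod (fun h => (fstSeminorm (q h)).comp T) ((fstSeminorm p).comp T)
        (fun c => hfst (T c)) c).const_mul a) (hlt c hc)
  -- Compactness of `A` turns the local statements into one that holds on all of `A` for large `h`.
  simp only [← eventually_iSup, ← hA.prod_nhdsSet_eq_biSup] at hev
  filter_upwards [hev.curry] with h hh
  exact eigenvalue_le_of_finite T hA hneg hg fun c hc => hh.self_of_nhdsSet c hc

theorem eventually_le_eigenvalue (hΩ : volume (Ω : Set (Euc N)) ≠ ⊤) {m : ℕ} {p : Exponent Ω}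
    {q : ℕ → Exponent Ω} {r S : ℝ} (hr : 1 ≤ r) (hrN : r < N)
    (hunif : ∀ δ > 0, ∀ᶠ h in atTop, ∀ x ∈ Ω, q h x - p x ≤ δ)
    (hle : ∀ h, ∀ x ∈ Ω, p x ≤ q h x) (hrq : ∀ᶠ h in atTop, ∀ x ∈ Ω, r ≤ q h x)
    (hS : ∀ᶠ h in atTop, ∀ x ∈ Ω, q h x ≤ S) (hs : S < N * r / (N - r)) {a b : ℝ}
    (hab : a < b) (hb : ENNReal.ofReal b < eigenvalue p m) :
    ∀ᶠ h in atTop, ENNReal.ofReal a ≤ eigenvalue (q h) m := by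
  obtain ⟨B, hB, hbound⟩ := exists_uniform_lintegral_bound hΩ hr hrN
  set s := N * r / (N - r)
  have hs0 : 0 ≤ s := div_nonneg (by positivity) (sub_nonneg.2 hrN.le)
  have hκ : Tendsto (fun δ : ℝ => δ / (s - S) * ((2 * a) ^ s * B)) (𝓝[>] 0) (𝓝 0) := by
    have : Continuous fun δ : ℝ => δ / (s - S) * ((2 * a) ^ s * B) := by fun_prop
    simpa using (this.tendsto 0).mono_left nhdsWithin_le_nhds
  have hV : Tendsto (fun δ : ℝ => 1 + δ * volume.real (Ω : Set (Euc N))) (𝓝[>] 0) (𝓝 1) := by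
    have : Continuous fun δ : ℝ => 1 + δ * volume.real (Ω : Set (Euc N)) := by fun_prop
    simpa using (this.tendsto 0).mono_left nhdsWithin_le_nhds
  have hlim : Tendsto (fun δ : ℝ => (1 + δ * volume.real (Ω : Set (Euc N))) *
      (a * (1 + δ / (s - S) * ((2 * a) ^ s * B)))) (𝓝[>] 0) (𝓝 a) := by
    simpa using hV.mul ((hκ.const_add 1).const_mul a)
  -- `δ` is fixed before `h` and before the coefficient set, as `B` depends on neither; the total
  -- loss of constants must fit between `a` and `b`.
  obtain ⟨δ, ⟨hδκ, hδb⟩, hδ⟩ := (((hκ.eventually_lt_const one_pos).and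
    (hlim.eventually_lt_const hab)).and self_mem_nhdsWithin).exists
  have hδ0 : 0 < δ := hδ
  filter_upwards [hunif δ hδ0, hrq, hS] with h hh hhr hhS
  by_contra! hlt
  obtain ⟨t, A, hA, hneg, hg, hA'⟩ := exists_finite_of_eigenvalue_lt hΩ hlt
  -- The set found for `q h` also competes for `p`, with constant `b`, which contradicts `hb`.
  refine hb.not_ge (eigenvalue_le_of_finite
    (Fintype.linearCombination ℝ (fun i : t => (i : testSpace Ω))) hA hneg hg fun c hc => ?_)
  have hφ := hA' c hc
  set φ := Fintype.linearCombination ℝ (fun i : t => (i : testSpace Ω)) c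
  obtain ⟨h1, h2⟩ := norm_snd_le_of_norm_snd_lt hΩ hs0 hs hB hδ0.le (hle h) hh hhS
    (hbound (q h) hhr) hδκ φ hφ
  have had : 0 < a * ‖(testPair (q h) φ).fst‖ := (norm_nonneg _).trans_lt hφ
  have hd : 0 < ‖(testPair (q h) φ).fst‖ :=
    (norm_nonneg _).lt_of_ne' fun h0 => by simp [h0] at had
  have ha : 0 < a := pos_of_mul_pos_left had hd.le
  have hκ0 : 0 ≤ δ / (s - S) * ((2 * a) ^ s * B) :=
    mul_nonneg (div_nonneg hδ0.le (sub_pos.2 hs).le) (by positivity)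
  have hp : 0 < ‖(testPair p φ).fst‖ := pos_of_mul_pos_left (hd.trans_le h1) (by positivity)
  calc ‖(testPair p φ).snd‖
      ≤ (1 + δ * volume.real (Ω : Set (Euc N))) * ‖(testPair (q h) φ).snd‖ := h2
    _ ≤ (1 + δ * volume.real (Ω : Set (Euc N))) * (a * (‖(testPair p φ).fst‖ *
          (1 + δ / (s - S) * ((2 * a) ^ s * B)))) := by
        gcongr
        exact hφ.le.trans (by gcongr)
    _ = (1 + δ * volume.real (Ω : Set (Euc N))) *
          (a * (1 + δ / (s - S) * ((2 * a) ^ s * B))) * ‖(testPair p φ).fst‖ := by ring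
    _ < b * ‖(testPair p φ).fst‖ := by gcongr

end Eigenvalues

end VarExp

end

theorem theorem1p1 {N : ℕ} (hN : 2 ≤ N) (Ω : TopologicalSpace.Opens (EuclideanSpace ℝ (Fin N)))
    (hbdd : Bornology.IsBounded (Ω : Set (EuclideanSpace ℝ (Fin N))))
    (hconn : IsConnected (Ω : Set (EuclideanSpace ℝ (Fin N))))
    (hlip : VarExp.HasLipschitzBoundary Ω)
    (m : ℕ) (hm : 1 ≤ m)
    (p : VarExp.Exponent Ω) (ph : ℕ → VarExp.Exponent Ω)
    (hS : VarExp.IsSubcriticalSeq ph)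
    (hunif : TendstoUniformlyOn (fun h x => ph h x) p Filter.atTop
      (Ω : Set (EuclideanSpace ℝ (Fin N))))
    (hle : ∀ h, ∀ x ∈ Ω, p x ≤ ph h x) :
    Filter.Tendsto (fun h => VarExp.eigenvalue (ph h) m) Filter.atTop
      (nhds (VarExp.eigenvalue p m)) := by
  have hΩ : MeasureTheory.volume (Ω : Set (EuclideanSpace ℝ (Fin N))) ≠ ⊤ :=
    hbdd.measure_lt_top.ne
  have hunif' : ∀ δ > 0, ∀ᶠ h in Filter.atTop, ∀ x ∈ Ω, ph h x - p x ≤ δ := by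
    intro δ hδ
    filter_upwards [Metric.tendstoUniformlyOn_iff.1 hunif δ hδ] with h hh x hx
    have := hh x hx
    rw [dist_comm, Real.dist_eq] at this
    exact (le_abs_self _).trans this.le
  obtain ⟨k, -, hk⟩ := hS
  dsimp only at hk
  -- `R` is nonempty and lies in `[1, N)`, so its real `sInf` and `sSup` are genuine bounds; `hk`
  -- places `sSup R` below the critical exponent of `sInf R`.
  set R : Set ℝ := {t | ∃ h, k ≤ h ∧ ∃ x ∈ Ω, t = ph h x}
  obtain ⟨x₀, hx₀⟩ := hconn.nonempty
  have hRne : R.Nonempty := ⟨ph k x₀, k, le_rfl, x₀, hx₀, rfl⟩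
  have hR1 : ∀ t ∈ R, 1 ≤ t := by
    rintro _ ⟨h, -, x, hx, rfl⟩
    exact (ph h).one_le hx
  have hRN : ∀ t ∈ R, t < N := by
    rintro _ ⟨h, -, x, hx, rfl⟩
    obtain ⟨b, hb, hbx⟩ := (ph h).sup_lt_dim
    exact (hbx x hx).trans_lt hb
  have hr1 : 1 ≤ sInf R := le_csInf hRne hR1
  have hrN : sInf R < N :=
    (csInf_le ⟨1, hR1⟩ ⟨k, le_rfl, x₀, hx₀, rfl⟩).trans_lt (hRN _ ⟨k, le_rfl, x₀, hx₀, rfl⟩)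
  have hrq : ∀ᶠ h in Filter.atTop, ∀ x ∈ Ω, sInf R ≤ ph h x := by
    filter_upwards [Filter.eventually_ge_atTop k] with h hh x hx
    exact csInf_le ⟨1, hR1⟩ ⟨h, hh, x, hx, rfl⟩
  have hSq : ∀ᶠ h in Filter.atTop, ∀ x ∈ Ω, ph h x ≤ sSup R := by
    filter_upwards [Filter.eventually_ge_atTop k] with h hh x hx
    exact le_csSup ⟨N, fun t ht => (hRN t ht).le⟩ ⟨h, hh, x, hx, rfl⟩
  have hs0 : 0 < N * sInf R / (N - sInf R) := by
    have : 0 < sInf R := by linarith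
    exact div_pos (mul_pos (by linarith) this) (sub_pos.2 hrN)
  -- Working with thresholds `l` on either side also covers an infinite limit.
  refine tendsto_order.2 ⟨fun l hl => ?_, fun l hl => ?_⟩
  · obtain ⟨a, ha0, hla, ha⟩ := ENNReal.lt_iff_exists_real_btwn.1 hl
    obtain ⟨b, hb0, hab, hb⟩ := ENNReal.lt_iff_exists_real_btwn.1 ha
    filter_upwards [VarExp.eventually_le_eigenvalue hΩ hr1 hrN hunif' hle hrq hSq hk
      ((ENNReal.ofReal_lt_ofReal_iff_of_nonneg ha0).1 hab) hb] with h hh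
    exact hla.trans_le hh
  · obtain ⟨a, ha0, ha, hal⟩ := ENNReal.lt_iff_exists_real_btwn.1 hl
    filter_upwards [VarExp.eventually_eigenvalue_le hΩ hunif' hle hSq hs0 hk ha] with h hh
    exact hh.trans_lt hal
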